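/- Let $n\ge 3$ and consider a convex $n$-gon with labelled vertices. For $0\le m\le n-3$, an $m$-dissection of the $n$-gon is a partition of it into $m+1$ polygons by $m$ pairwise noncrossing diagonals (two diagonals are noncrossing if they have no common interior point); a triangulation is an $(n-3)$-dissection. Two dissections are the same if and only if they use the same set of diagonals. For $4\le k\le n$, a $k$-in-$n$ dissection is an $(n-k)$-dissection of the $n$-gon whose parts are one $k$-gon and $n-k$ triangles. A $3$-in-$n$ dissection is a triangulation of the $n$-gon together with a choice of one of its $n-2$ triangles (the marked triangle). Let $f_k(n)$ denote the number of $k$-in-$n$ dissections. **Theorem.** For all integers $3\le k\le n$, $$f_k(n)=\binom{2n-k-1}{n-1}.$$ -/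

import Mathlib

/-! Dissections of a convex `n`-gon whose vertices are labelled `0, 1, …, n - 1` in cyclic order.
A segment between two distinct vertices `i < j` is recorded as the pair `(i, j)`. -/

namespace PolygonDissection

/-- `e = (i, j)` is a side of the convex polygon with vertex set `P`: `i < j` are vertices in `P`
that are cyclically consecutive in `P`, i.e. no vertex of `P` lies strictly between them, or
no vertex of `P` lies outside the range from `i` to `j`. -/
def IsSide {n : ℕ} (P : Finset (Fin n)) (e : Fin n × Fin n) : Prop :=
  e.1 ∈ P ∧ e.2 ∈ P ∧ e.1 < e.2 ∧
    ((∀ x ∈ P, ¬ (e.1 < x ∧ x < e.2)) ∨ (∀ x ∈ P, e.1 ≤ x ∧ x ≤ e.2))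

/-- `e = (i, j)` with `i < j` is a diagonal of the convex polygon with vertex set `P`: it joins
two distinct vertices of `P` and is not a side. -/
def IsDiagonal {n : ℕ} (P : Finset (Fin n)) (e : Fin n × Fin n) : Prop :=
  e.1 ∈ P ∧ e.2 ∈ P ∧ e.1 < e.2 ∧ ¬ IsSide P e

/-- Two segments cross (meet in a common interior point) iff their endpoints strictly
interleave. -/
def Crosses {n : ℕ} (e f : Fin n × Fin n) : Prop :=
  (e.1 < f.1 ∧ f.1 < e.2 ∧ e.2 < f.2) ∨ (f.1 < e.1 ∧ e.1 < f.2 ∧ f.2 < e.2)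

/-- `D` is (the set of diagonals of) an `m`-dissection of the `n`-gon: `m` pairwise noncrossing
diagonals of the `n`-gon. -/
def IsDissection {n : ℕ} (m : ℕ) (D : Finset (Fin n × Fin n)) : Prop :=
  D.card = m ∧ (∀ e ∈ D, IsDiagonal Finset.univ e) ∧ (∀ e ∈ D, ∀ f ∈ D, ¬ Crosses e f)

/-- The polygon with vertex set `P` is one of the parts into which the diagonals in `D` cut the
`n`-gon: each of its sides is a side of the `n`-gon or belongs to `D`, and none of its
diagonals belongs to `D` (so it is not cut any further). -/
def IsPart {n : ℕ} (D : Finset (Fin n × Fin n)) (P : Finset (Fin n)) : Prop :=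
  3 ≤ P.card ∧ (∀ e, IsSide P e → IsSide Finset.univ e ∨ e ∈ D) ∧ (∀ e, IsDiagonal P e → e ∉ D)

instance {n : ℕ} (P : Finset (Fin n)) (e : Fin n × Fin n) : Decidable (IsSide P e) := by
  unfold IsSide; infer_instance

instance {n : ℕ} (P : Finset (Fin n)) (e : Fin n × Fin n) : Decidable (IsDiagonal P e) := by
  unfold IsDiagonal; infer_instance

instance {n : ℕ} (e f : Fin n × Fin n) : Decidable (Crosses e f) := by
  unfold Crosses; infer_instance

instance {n : ℕ} (m : ℕ) (D : Finset (Fin n × Fin n)) : Decidable (IsDissection m D) := by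
  unfold IsDissection; infer_instance

instance {n : ℕ} (D : Finset (Fin n × Fin n)) (P : Finset (Fin n)) : Decidable (IsPart D P) := by
  unfold IsPart; infer_instance

/-- The parts of the `n`-gon cut out by `D`, each given by its vertex set. -/
def parts {n : ℕ} (D : Finset (Fin n × Fin n)) : Finset (Finset (Fin n)) :=
  Finset.univ.filter (fun P => IsPart D P)

/-- A triangulation of the `n`-gon is an `(n - 3)`-dissection. -/
def IsTriangulation {n : ℕ} (D : Finset (Fin n × Fin n)) : Prop :=
  IsDissection (n - 3) D

/-- For `4 ≤ k ≤ n`: `D` is an `(n - k)`-dissection of the `n`-gon whose parts are one `k`-gon and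
`n - k` triangles. -/
def IsKInN {n : ℕ} (k : ℕ) (D : Finset (Fin n × Fin n)) : Prop :=
  IsDissection (n - k) D ∧
    (parts D).val.map Finset.card = k ::ₘ Multiset.replicate (n - k) 3

/-- A `3`-in-`n` dissection: a triangulation `p.1` together with a marked triangle `p.2` of it. -/
def IsMarkedTriangulation {n : ℕ} (p : Finset (Fin n × Fin n) × Finset (Fin n)) : Prop :=
  IsTriangulation p.1 ∧ p.2 ∈ parts p.1 ∧ p.2.card = 3

instance {n : ℕ} (D : Finset (Fin n × Fin n)) : Decidable (IsTriangulation D) := by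
  unfold IsTriangulation; infer_instance

instance {n : ℕ} (k : ℕ) (D : Finset (Fin n × Fin n)) : Decidable (IsKInN k D) := by
  unfold IsKInN; infer_instance

instance {n : ℕ} (p : Finset (Fin n × Fin n) × Finset (Fin n)) :
    Decidable (IsMarkedTriangulation p) := by
  unfold IsMarkedTriangulation; infer_instance

/-- `f_k(n)`, the number of `k`-in-`n` dissections (`3 ≤ k ≤ n`). -/
def f (k n : ℕ) : ℕ :=
  if k = 3 then
    (Finset.univ.filter
      (fun p : Finset (Fin n × Fin n) × Finset (Fin n) => IsMarkedTriangulation p)).card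
  else
    (Finset.univ.filter (fun D : Finset (Fin n × Fin n) => IsKInN k D)).card

end PolygonDissection

namespace PolygonDissection

/-! Seen from the part `P`, every diagonal cuts off a boundary arc, which has a first endpoint in
the cyclic order. Recording these endpoints encodes a `k`-in-`n` dissection as a multiset of `n - k`
vertices. The code is a bijection onto all such multisets, and there are `(2n - k - 1).choose (n -
k)` of them. The inverse peels off ears. If `a` lies in the multiset and its successor `v` does not,
then `v` must be the tip of an ear outside `P`, cut off by the diagonal from `a` to the successor
`b` of `v` (`Tight.ear_of_code`). Removing `v`, that diagonal and one copy of `a` gives the same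
situation on a smaller vertex set; this is why polygons are arbitrary vertex sets `V`.
`exists_tight_code` and `tight_code_injective` are the two halves. The condition "all other parts
are triangles" is replaced by the equation `D.card + P.card = V.card`, the extremal case of
`Config.card_le`; `Tight.map_card_parts` recovers the sizes of the parts. -/

/-- `v` follows `a` in the cyclic order of the vertex set `V`. -/
def Next {n : ℕ} (V : Finset (Fin n)) (a v : Fin n) : Prop :=
  a ∈ V ∧ v ∈ V ∧ ((a < v ∧ ∀ x ∈ V, ¬ (a < x ∧ x < v)) ∨ (v < a ∧ ∀ x ∈ V, v ≤ x ∧ x ≤ a))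

/-- The segment with endpoints `a` and `b`, smaller endpoint first. -/
def seg {n : ℕ} (a b : Fin n) : Fin n × Fin n := if a < b then (a, b) else (b, a)

/-- `D` is a set of pairwise noncrossing diagonals of the polygon with vertex set `V`, and `P` is
one of the parts into which it cuts that polygon. -/
structure Config {n : ℕ} (V : Finset (Fin n)) (D : Finset (Fin n × Fin n)) (P : Finset (Fin n)) :
    Prop where
  diag : ∀ e ∈ D, IsDiagonal V e
  nc : ∀ e ∈ D, ∀ f ∈ D, ¬ Crosses e f
  sub : P ⊆ V
  card : 3 ≤ P.card
  side : ∀ e, IsSide P e → IsSide V e ∨ e ∈ D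
  ndiag : ∀ e, IsDiagonal P e → e ∉ D

/-- The segment `e` has all of `P` weakly between its endpoints. -/
def Encl {n : ℕ} (P : Finset (Fin n)) (e : Fin n × Fin n) : Prop := ∀ x ∈ P, e.1 ≤ x ∧ x ≤ e.2

instance {n : ℕ} (P : Finset (Fin n)) (e : Fin n × Fin n) : Decidable (Encl P e) := by
  unfold Encl; infer_instance

/-- The first endpoint of `e` when the boundary arc cut off from `P` by `e` is traversed upwards. -/
def start {n : ℕ} (P : Finset (Fin n)) (e : Fin n × Fin n) : Fin n :=
  if Encl P e then e.2 else e.1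

/-- The vertices of `V` cut off from `P` by `e`. -/
def off {n : ℕ} (V P : Finset (Fin n)) (e : Fin n × Fin n) : Finset (Fin n) :=
  V.filter fun x => if Encl P e then x < e.1 ∨ e.2 < x else e.1 < x ∧ x < e.2

/-- The multiset of starting points of the diagonals in `D`. -/
def code {n : ℕ} (P : Finset (Fin n)) (D : Finset (Fin n × Fin n)) : Multiset (Fin n) :=
  D.val.map (start P)

variable {n : ℕ} {V P Q : Finset (Fin n)} {D : Finset (Fin n × Fin n)} {a v b x y w : Fin n}
  {e f : Fin n × Fin n}

/-! ### Cyclic order and sides. -/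

theorem exists_mem_ne_ne (h : 3 ≤ P.card) (a b : Fin n) : ∃ x ∈ P, x ≠ a ∧ x ≠ b := by
  by_contra! hc
  have : P ⊆ {a, b} := fun x hx => by
    by_cases hxa : x = a
    · simp [hxa]
    · simp [hc x hx hxa]
  have := (Finset.card_le_card this).trans Finset.card_le_two
  omega

theorem Next.right_unique (h : Next V a v) (h' : Next V a w) : v = w := by
  unfold Next at *; grind

theorem Next.left_unique (h : Next V a v) (h' : Next V b v) : a = b := by
  unfold Next at *; grind

theorem Next.erase (h : Next V a v) (ha : w ≠ a) (hv : w ≠ v) : Next (V.erase w) a v := by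
  unfold Next at *; grind

theorem exists_greatest_lt (h : ∃ y ∈ V, y < x) : ∃ y ∈ V, y < x ∧ ∀ z ∈ V, ¬ (y < z ∧ z < x) := by
  obtain ⟨y, hy, hm⟩ := (V.filter (· < x)).exists_max_image id (by
    obtain ⟨y, hy, h⟩ := h; exact ⟨y, by simp [hy, h]⟩)
  simp only [Finset.mem_filter, id] at hy hm
  exact ⟨y, hy.1, hy.2, fun z hz hh => absurd (hm z ⟨hz, hh.2⟩) (not_le.2 hh.1)⟩

theorem exists_least_gt (h : ∃ y ∈ V, x < y) : ∃ y ∈ V, x < y ∧ ∀ z ∈ V, ¬ (x < z ∧ z < y) := by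
  obtain ⟨y, hy, hm⟩ := (V.filter (x < ·)).exists_min_image id (by
    obtain ⟨y, hy, h⟩ := h; exact ⟨y, by simp [hy, h]⟩)
  simp only [Finset.mem_filter, id] at hy hm
  exact ⟨y, hy.1, hy.2, fun z hz hh => absurd (hm z ⟨hz, hh.1⟩) (not_le.2 hh.2)⟩

theorem exists_next (hx : x ∈ V) (hw : w ∈ V) (hne : w ≠ x) : ∃ y, Next V x y := by
  by_cases h : ∃ y ∈ V, x < y
  · obtain ⟨y, hy, h1, h2⟩ := exists_least_gt h
    exact ⟨y, hx, hy, Or.inl ⟨h1, h2⟩⟩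
  · push Not at h
    have hV : V.Nonempty := ⟨x, hx⟩
    have h1 := V.min'_mem hV
    have h2 := fun z hz => V.min'_le z hz
    exact ⟨V.min' hV, hx, h1, Or.inr ⟨by grind, fun z hz => ⟨h2 z hz, h z hz⟩⟩⟩

theorem exists_prev (hx : x ∈ V) (hw : w ∈ V) (hne : w ≠ x) : ∃ y, Next V y x := by
  by_cases h : ∃ y ∈ V, y < x
  · obtain ⟨y, hy, h1, h2⟩ := exists_greatest_lt h
    exact ⟨y, hy, hx, Or.inl ⟨h1, h2⟩⟩
  · push Not at h
    have hV : V.Nonempty := ⟨x, hx⟩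
    have h1 := V.max'_mem hV
    have h2 := fun z hz => V.le_max' z hz
    exact ⟨V.max' hV, h1, hx, Or.inr ⟨by grind, fun z hz => ⟨h z hz, h2 z hz⟩⟩⟩

/-- Going once round the polygon, `p` must switch from true to false somewhere: either along an
upward step, or else at the wrap-around from the maximum to the minimum. -/
theorem exists_next_mem_not_mem {p : Fin n → Prop} (hx : x ∈ V) (hpx : p x) (hw : w ∈ V)
    (hpw : ¬ p w) : ∃ a v, Next V a v ∧ p a ∧ ¬ p v := by
  classical
  by_cases h : ∃ s ∈ V, p s ∧ ∃ z ∈ V, ¬ p z ∧ s < z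
  · obtain ⟨s, hs, hps, h⟩ := h
    obtain ⟨z, hz, hsz, hz'⟩ := exists_least_gt (V := V.filter (¬ p ·)) (x := s) (by
      obtain ⟨z, h1, h2, h3⟩ := h; exact ⟨z, by simp [h1, h2], h3⟩)
    obtain ⟨a, ha, haz, ha'⟩ := exists_greatest_lt ⟨s, hs, hsz⟩
    refine ⟨a, z, ⟨ha, by grind, Or.inl ⟨haz, ha'⟩⟩, ?_, by grind⟩
    by_contra hpa
    have := ha' s hs
    have := hz' a (by simp [ha, hpa])
    grind
  · push Not at h
    have hV : V.Nonempty := ⟨x, hx⟩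
    have h1 := V.max'_mem hV
    have h2 := fun z hz => V.le_max' z hz
    have h3 := V.min'_mem hV
    have h4 := fun z hz => V.min'_le z hz
    have hp1 : p (V.max' hV) := by
      by_contra hc
      have := h x hx hpx _ h1 hc
      grind
    have hp2 : ¬ p (V.min' hV) := by
      intro hc
      have := h _ h3 hc w hw hpw
      grind
    exact ⟨V.max' hV, V.min' hV, ⟨h1, h3, Or.inr ⟨by grind, fun z hz => ⟨h4 z hz, h2 z hz⟩⟩⟩,
      hp1, hp2⟩

theorem isSide_erase (h : IsSide V e) (h1 : e.1 ≠ v) (h2 : e.2 ≠ v) : IsSide (V.erase v) e := by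
  unfold IsSide at *; grind

theorem IsSide.mono (h : IsSide V e) (hs : P ⊆ V) (h1 : e.1 ∈ P) (h2 : e.2 ∈ P) :
    IsSide P e := by
  unfold IsSide at *; grind

theorem Next.isSide_erase (hav : Next V a v) (hvb : Next V v b) (hab : a ≠ b) :
    IsSide (V.erase v) (seg a b) := by
  unfold IsSide Next seg at *; grind

theorem Next.isSide_of_erase (hav : Next V a v) (hvb : Next V v b)
    (h : IsSide (V.erase v) e) : IsSide V e ∨ e = seg a b := by
  obtain ⟨e1, e2⟩ := e
  obtain ⟨ha, hv, hav⟩ := hav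
  obtain ⟨-, hb, hvb⟩ := hvb
  obtain ⟨h1, h2, hlt, h⟩ := h
  simp only [Finset.mem_erase] at h1 h2 h hlt
  have hva := h.imp (· a) (· a)
  have hvb' := h.imp (· b) (· b)
  unfold IsSide seg
  rcases hav with hav | hav <;> rcases hvb with hvb | hvb <;> rcases h with h | h <;> grind

theorem Next.isSide (hav : Next V a v) : IsSide V (seg a v) := by
  unfold IsSide Next seg at *; grind

theorem IsSide.next (h : IsSide V (seg a v)) : Next V a v ∨ Next V v a := by
  unfold IsSide Next seg at *; grind

theorem not_crosses_of_isSide (h : IsSide V e) (h1 : f.1 ∈ V) (h2 : f.2 ∈ V) :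
    ¬ Crosses e f ∧ ¬ Crosses f e := by
  unfold IsSide Crosses at *; grind

theorem Next.not_isSide (hav : Next V a v) (hvb : Next V v b) (hx : x ∈ V)
    (hxa : x ≠ a) (hxb : x ≠ b) (hxv : x ≠ v) : ¬ IsSide V (seg a b) := by
  unfold IsSide Next seg at *; grind

/-! ### Diagonals as seen from the part `P`. -/

theorem Next.eq_snd (hpq : Next P a b) (ha : e.1 < a ∧ a < e.2) (hb : ¬ (e.1 < b ∧ b < e.2))
    (hc : ¬ Crosses (seg a b) e) (hy : y ∈ P) (hy' : y < e.1 ∨ e.2 < y) : b = e.2 := by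
  obtain ⟨e1, e2⟩ := e
  unfold Crosses seg Next at *
  grind

theorem Next.eq_fst (hpq : Next P a b) (hb : e.1 < b ∧ b < e.2) (ha : ¬ (e.1 < a ∧ a < e.2))
    (hc : ¬ Crosses (seg a b) e) (hy : y ∈ P) (hy' : y < e.1 ∨ e.2 < y) : a = e.1 := by
  obtain ⟨e1, e2⟩ := e
  unfold Crosses seg Next at *
  grind

/-- If `P` had vertices strictly on both sides of `e`, the sides of `P` leaving and entering the
range of `e` could avoid crossing `e` only by passing through its endpoints. Then `e` would be a
diagonal of `P` belonging to `D`. -/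
theorem Config.sep (h : Config V D P) (he : e ∈ D) :
    Encl P e ∨ ∀ x ∈ P, ¬ (e.1 < x ∧ x < e.2) := by
  by_contra! hc
  obtain ⟨hy, x, hx, hx1, hx2⟩ := hc
  unfold Encl at hy
  push Not at hy
  obtain ⟨y, hy, hy'⟩ := hy
  have hlt := (h.diag e he).2.2.1
  have hyo : y < e.1 ∨ e.2 < y := by
    by_cases h : e.1 ≤ y
    · exact Or.inr (hy' h)
    · exact Or.inl (not_le.1 h)
  have hyn : ¬ (e.1 < y ∧ y < e.2) := fun hh => hyo.elim hh.1.asymm hh.2.asymm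
  have key : ∀ p q, Next P p q → ¬ Crosses (seg p q) e := by
    intro p q hpq
    have := (h.diag e he)
    rcases h.side _ hpq.isSide with h1 | h1
    · exact (not_crosses_of_isSide h1 this.1 this.2.1).1
    · exact h.nc _ h1 _ he
  have he2 : e.2 ∈ P := by
    obtain ⟨p, q, hpq, h1, h2⟩ := exists_next_mem_not_mem (p := fun a => e.1 < a ∧ a < e.2)
      hx ⟨hx1, hx2⟩ hy hyn
    exact hpq.eq_snd h1 h2 (key p q hpq) hy hyo ▸ hpq.2.1
  have he1 : e.1 ∈ P := by
    obtain ⟨p, q, hpq, h1, h2⟩ := exists_next_mem_not_mem (p := fun a => ¬ (e.1 < a ∧ a < e.2))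
      hy hyn hx (not_not.2 ⟨hx1, hx2⟩)
    exact hpq.eq_fst (not_not.1 h2) h1 (key p q hpq) hy hyo ▸ hpq.1
  refine h.ndiag e ⟨he1, he2, hlt, ?_⟩ he
  rintro ⟨-, -, -, hs | hs⟩
  · exact hs x hx ⟨hx1, hx2⟩
  · have := hs y hy
    exact hyo.elim (not_lt.2 this.1) (not_lt.2 this.2)

/-- As `f` does not cross `e` and ends beyond it, it stays on the side of `e` away from `P`; its
endpoint `v` is not itself cut off by `f`, so the inclusion is strict. -/
theorem Config.off_ssubset (h : Config V D P) (he : e ∈ D) (hf : f ∈ D) (hv : v ∈ off V P e)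
    (hfv : f.1 = v ∨ f.2 = v) : off V P f ⊂ off V P e := by
  obtain ⟨p, hp, hp1, hp2⟩ := exists_mem_ne_ne h.card e.1 e.2
  obtain ⟨q, hq, hq1, hq2⟩ := exists_mem_ne_ne h.card f.1 f.2
  have h1 := h.nc e he f hf
  have hel := (h.diag e he).2.2.1
  have hfl := (h.diag f hf).2.2.1
  -- The vertices `p` and `q` of `P`, chosen off the ends of `e` and `f`, witness on which side `P`
  -- lies, reducing the claim to inequalities.
  have aux : ∀ e ∈ D, (Encl P e ∧ (e.1 ≤ p ∧ p ≤ e.2) ∧ (e.1 ≤ q ∧ q ≤ e.2)) ∨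
      (¬ Encl P e ∧ ¬ (e.1 < p ∧ p < e.2) ∧ ¬ (e.1 < q ∧ q < e.2)) := fun e he => by
    by_cases hE : Encl P e
    · exact Or.inl ⟨hE, hE p hp, hE q hq⟩
    · have := (h.sep he).resolve_left hE
      exact Or.inr ⟨hE, this p hp, this q hq⟩
  have he' := aux e he
  have hf' := aux f hf
  have hvn : v ∉ off V P f := by
    unfold off; grind
  refine (Finset.ssubset_iff_of_subset fun x hx => ?_).2 ⟨v, hv, hvn⟩
  obtain ⟨i, j⟩ := e
  obtain ⟨k, l⟩ := f
  clear hvn aux h he hf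
  simp only [off, Finset.mem_filter] at *
  refine ⟨hx.1, ?_⟩
  replace hx := hx.2
  replace hv := hv.2
  unfold Crosses at h1
  rcases he' with ⟨hE, he'⟩ | ⟨hE, he'⟩ <;> rcases hf' with ⟨hF, hf'⟩ | ⟨hF, hf'⟩ <;>
    simp only [hE, hF, if_true, if_false] at hv hx ⊢ <;> clear hE hF <;> grind

theorem Config.off_nonempty (h : Config V D P) (he : e ∈ D) : (off V P e).Nonempty := by
  obtain ⟨h1, h2, h3, h4⟩ := h.diag e he
  unfold IsSide at h4
  push Not at h4
  obtain ⟨⟨x, hx, hx'⟩, y, hy, hy'⟩ := h4 h1 h2 h3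
  by_cases hE : Encl P e
  · exact ⟨y, by simp only [off, Finset.mem_filter, hE, if_true]; grind⟩
  · exact ⟨x, by simp only [off, Finset.mem_filter, hE, if_false]; grind⟩

theorem Config.notMem_of_mem_off (h : Config V D P) (he : e ∈ D) (hv : v ∈ off V P e) : v ∉ P := by
  intro hvP
  simp only [off, Finset.mem_filter] at hv
  by_cases hE : Encl P e
  · have := hE v hvP
    rw [if_pos hE] at hv
    grind
  · rw [if_neg hE] at hv
    exact (h.sep he).resolve_left hE v hvP hv.2

/-- A diagonal cutting off the fewest vertices has no diagonal ending among them, by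
`Config.off_ssubset`. -/
theorem Config.exists_isolated (h : Config V D P) (hP : P ≠ V) :
    ∃ v ∈ V, v ∉ P ∧ ∀ e ∈ D, e.1 ≠ v ∧ e.2 ≠ v := by
  rcases D.eq_empty_or_nonempty with rfl | hD
  · obtain ⟨v, hv, hvP⟩ := Finset.exists_of_ssubset (h.sub.ssubset_of_ne hP)
    exact ⟨v, hv, hvP, by simp⟩
  · obtain ⟨e, he, hmin⟩ := D.exists_min_image (fun e => (off V P e).card) hD
    obtain ⟨v, hv⟩ := h.off_nonempty he
    refine ⟨v, (Finset.mem_filter.1 hv).1, h.notMem_of_mem_off he hv, fun f hf => ?_⟩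
    by_contra hc
    have hfv : f.1 = v ∨ f.2 = v := by tauto
    exact (Finset.card_lt_card (h.off_ssubset he hf hv hfv)).not_ge (hmin f hf)

/-! ### Removing and attaching ears. -/

/-- Three vertices of the polygon `V` that are cyclically consecutive. -/
structure Ear (V : Finset (Fin n)) (a v b : Fin n) : Prop where
  left : Next V a v
  right : Next V v b
  ne : a ≠ b

theorem Config.exists_ear (h : Config V D P) (hv : v ∈ V) : ∃ a b, Ear V a v b := by
  obtain ⟨w, hw, hwv, -⟩ := exists_mem_ne_ne h.card v v
  obtain ⟨b, hb⟩ := exists_next hv (h.sub hw) hwv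
  obtain ⟨a, ha⟩ := exists_prev hv (h.sub hw) hwv
  obtain ⟨x, hx, hxa, hxv⟩ := exists_mem_ne_ne h.card a v
  have := h.sub hx
  refine ⟨a, b, ha, hb, ?_⟩
  unfold Next at *
  grind

theorem seg_fst_snd (h : e = seg a b) : e.1 = a ∧ e.2 = b ∨ e.1 = b ∧ e.2 = a := by
  unfold seg at h; grind

theorem Ear.isDiagonal_seg (hE : Ear V a v b) (hx : x ∈ V) (hxa : x ≠ a) (hxb : x ≠ b)
    (hxv : x ≠ v) : IsDiagonal V (seg a b) := by
  refine ⟨?_, ?_, ?_, hE.left.not_isSide hE.right hx hxa hxb hxv⟩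
  · have := hE.left.1; have := hE.right.2.1; unfold seg; grind
  · have := hE.left.1; have := hE.right.2.1; unfold seg; grind
  · have := hE.ne; unfold seg; grind

/-- Without `v`, the segment from `a` to `b` becomes a side, so it has to leave `D`. -/
theorem Config.erase (h : Config V D P) (hE : Ear V a v b) (hvP : v ∉ P)
    (hiso : ∀ e ∈ D, e.1 ≠ v ∧ e.2 ≠ v) : Config (V.erase v) (D.erase (seg a b)) P where
  diag e he := by
    obtain ⟨hne, he⟩ := Finset.mem_erase.1 he
    obtain ⟨h1, h2, h3, h4⟩ := h.diag e he
    refine ⟨by simp [h1, (hiso e he).1], by simp [h2, (hiso e he).2], h3, fun hs => ?_⟩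
    exact (hE.left.isSide_of_erase hE.right hs).elim h4 hne
  nc e he f hf := h.nc e (Finset.mem_of_mem_erase he) f (Finset.mem_of_mem_erase hf)
  sub x hx := Finset.mem_erase.2 ⟨fun hxv => hvP (hxv ▸ hx), h.sub hx⟩
  card := h.card
  side e he := by
    by_cases hab : e = seg a b
    · exact Or.inl (hab ▸ hE.left.isSide_erase hE.right hE.ne)
    · refine (h.side e he).imp (fun hs => isSide_erase hs ?_ ?_) fun hs => by simp [hab, hs]
      · exact fun h => hvP (h ▸ he.1)
      · exact fun h => hvP (h ▸ he.2.1)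
  ndiag e he hD := h.ndiag e he (Finset.mem_of_mem_erase hD)

theorem Ear.seg_notMem (hE : Ear V a v b) (h : Config (V.erase v) D P) : seg a b ∉ D :=
  fun hs => (h.diag _ hs).2.2.2 (hE.left.isSide_erase hE.right hE.ne)

theorem Config.insert (h : Config (V.erase v) D P) (hE : Ear V a v b) :
    Config V (insert (seg a b) D) P := by
  have hside := hE.left.isSide_erase hE.right hE.ne
  have hc : ∀ e ∈ D, ¬ Crosses (seg a b) e ∧ ¬ Crosses e (seg a b) := fun e he =>
    not_crosses_of_isSide hside (h.diag e he).1 (h.diag e he).2.1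
  have hc' : ¬ Crosses (seg a b) (seg a b) :=
    (not_crosses_of_isSide hside hside.1 hside.2.1).1
  refine ⟨fun e he => ?_, fun e he f hf => ?_, h.sub.trans (Finset.erase_subset _ _), h.card,
    fun e he => ?_, fun e he hD => ?_⟩
  · rcases Finset.mem_insert.1 he with rfl | he
    · obtain ⟨x, hx, hxa, hxb⟩ := exists_mem_ne_ne h.card a b
      have := Finset.mem_erase.1 (h.sub hx)
      exact hE.isDiagonal_seg this.2 hxa hxb this.1
    · obtain ⟨h1, h2, h3, h4⟩ := h.diag e he
      exact ⟨Finset.mem_of_mem_erase h1, Finset.mem_of_mem_erase h2, h3, fun hs =>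
        h4 (isSide_erase hs (Finset.ne_of_mem_erase h1) (Finset.ne_of_mem_erase h2))⟩
  · rcases Finset.mem_insert.1 he with rfl | he <;> rcases Finset.mem_insert.1 hf with rfl | hf
    · exact hc'
    · exact (hc f hf).1
    · exact (hc e he).2
    · exact h.nc e he f hf
  · rcases h.side e he with hs | hs
    · exact (hE.left.isSide_of_erase hE.right hs).imp id fun h => by simp [h]
    · exact Or.inr (Finset.mem_insert_of_mem hs)
  · rcases Finset.mem_insert.1 hD with rfl | hD
    · exact he.2.2.2 (hside.mono h.sub he.1 he.2.1)
    · exact h.ndiag e he hD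

/-- Each ear removal costs one vertex and at most one diagonal. -/
theorem Config.card_le {V P : Finset (Fin n)} {D : Finset (Fin n × Fin n)} (h : Config V D P) :
    D.card + P.card ≤ V.card := by
  by_cases hP : P = V
  · subst hP
    have : D = ∅ := Finset.eq_empty_of_forall_notMem fun e he => h.ndiag e (h.diag e he) he
    simp [this]
  · obtain ⟨v, hv, hvP, hiso⟩ := h.exists_isolated hP
    obtain ⟨a, b, hE⟩ := h.exists_ear hv
    have hlt := Finset.card_erase_lt_of_mem hv
    have := (h.erase hE hvP hiso).card_le
    have := Finset.pred_card_le_card_erase (s := D) (a := seg a b)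
    omega
termination_by V.card

/-! ### Tight configurations and their codes. -/

/-- A configuration with as many diagonals as possible: all parts other than `P` are triangles. -/
structure Tight (V : Finset (Fin n)) (D : Finset (Fin n × Fin n)) (P : Finset (Fin n)) : Prop
    extends Config V D P where
  card_eq : D.card + P.card = V.card

theorem Tight.seg_mem (h : Tight V D P) (hE : Ear V a v b) (hvP : v ∉ P)
    (hiso : ∀ e ∈ D, e.1 ≠ v ∧ e.2 ≠ v) : seg a b ∈ D := by
  by_contra hn
  have h1 := (h.toConfig.erase hE hvP hiso).card_le
  rw [Finset.erase_eq_of_notMem hn] at h1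
  have := Finset.card_erase_lt_of_mem hE.left.2.1
  have := h.card_eq
  omega

theorem Tight.erase (h : Tight V D P) (hE : Ear V a v b) (hvP : v ∉ P)
    (hiso : ∀ e ∈ D, e.1 ≠ v ∧ e.2 ≠ v) : Tight (V.erase v) (D.erase (seg a b)) P where
  toConfig := h.toConfig.erase hE hvP hiso
  card_eq := by
    have h1 := Finset.card_erase_add_one (h.seg_mem hE hvP hiso)
    have h2 := Finset.card_erase_add_one hE.left.2.1
    have := h.card_eq
    omega

theorem Tight.insert (h : Tight (V.erase v) D P) (hE : Ear V a v b) :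
    Tight V (insert (seg a b) D) P where
  toConfig := h.toConfig.insert hE
  card_eq := by
    rw [Finset.card_insert_of_notMem (hE.seg_notMem h.toConfig)]
    have h2 := Finset.card_erase_add_one hE.left.2.1
    have := h.card_eq
    omega

theorem Tight.exists_ear (h : Tight V D P) (hP : P ≠ V) : ∃ a v b, Ear V a v b ∧ v ∉ P ∧
    (∀ e ∈ D, e.1 ≠ v ∧ e.2 ≠ v) ∧ seg a b ∈ D := by
  obtain ⟨v, hv, hvP, hiso⟩ := h.exists_isolated hP
  obtain ⟨a, b, hE⟩ := h.toConfig.exists_ear hv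
  exact ⟨a, v, b, hE, hvP, hiso, h.seg_mem hE hvP hiso⟩

/-- The arc cut off from `P` is `a`, `v`, `b`; the case split is whether `v` lies outside or inside
the range of the segment. -/
theorem Ear.start_seg (hE : Ear V a v b) (hP : P ⊆ V.erase v) (h3 : 3 ≤ P.card) :
    start P (seg a b) = a := by
  obtain ⟨p, hp, hpa, hpb⟩ := exists_mem_ne_ne h3 a b
  obtain ⟨hav, hvb, hne⟩ := hE
  have hp' := Finset.mem_erase.1 (hP hp)
  unfold start
  split_ifs with h
  · have h1 := h p hp
    clear h
    unfold Next seg at *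
    grind
  · unfold Encl at h
    push Not at h
    obtain ⟨q, hq, hq'⟩ := h
    have := Finset.mem_erase.1 (hP hq)
    unfold Next seg at *
    grind

theorem Ear.code_insert (hE : Ear V a v b) (h : Config (V.erase v) D P) :
    code P (insert (seg a b) D) = a ::ₘ code P D := by
  rw [code, Finset.insert_val_of_notMem (hE.seg_notMem h), Multiset.map_cons,
    hE.start_seg h.sub h.card, code]

theorem Tight.code_erase (h : Tight V D P) (hE : Ear V a v b) (hvP : v ∉ P)
    (hiso : ∀ e ∈ D, e.1 ≠ v ∧ e.2 ≠ v) : code P D = a ::ₘ code P (D.erase (seg a b)) := by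
  rw [← hE.code_insert (h.erase hE hvP hiso).toConfig,
    Finset.insert_erase (h.seg_mem hE hvP hiso)]

theorem exists_mem_of_mem_code (h : a ∈ code P D) : ∃ e ∈ D, e.1 = a ∨ e.2 = a := by
  obtain ⟨e, he, rfl⟩ := Multiset.mem_map.1 h
  refine ⟨e, he, ?_⟩
  unfold start
  split_ifs <;> simp

/-- Remove some other ear with tip `w`. It leaves `a`, `v`, `b` consecutive and `a` in the code, so
induction applies, and the removed diagonal does not end at `v`. -/
theorem Tight.ear_of_code {V P : Finset (Fin n)} {D : Finset (Fin n × Fin n)} {b : Fin n}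
    (h : Tight V D P) (hE : Ear V a v b) (ha : a ∈ code P D) (hv : v ∉ code P D) :
    v ∉ P ∧ ∀ e ∈ D, e.1 ≠ v ∧ e.2 ≠ v := by
  have hP : P ≠ V := by
    rintro rfl
    obtain ⟨e, he, -⟩ := exists_mem_of_mem_code ha
    exact h.ndiag e (h.diag e he) he
  obtain ⟨x, w, y, hF, hwP, hiso, hmem⟩ := h.exists_ear hP
  by_cases hwv : w = v
  · subst hwv
    exact ⟨hwP, hiso⟩
  have hwa : w ≠ a := by
    rintro rfl
    obtain ⟨e, he, h1⟩ := exists_mem_of_mem_code ha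
    exact h1.elim (hiso e he).1 (hiso e he).2
  -- An ear with tip `b` would be cut off by a diagonal starting at `v`, putting `v` in the code.
  have hwb : w ≠ b := by
    rintro rfl
    rw [h.code_erase hF hwP hiso, hF.left.left_unique hE.right] at hv
    simp at hv
  have hxa : a ≠ x := by
    rintro rfl
    exact hwv (hF.left.right_unique hE.left)
  have hxv : x ≠ v := by
    rintro rfl
    exact hwb (hF.left.right_unique hE.right)
  have hyv : y ≠ v := by
    rintro rfl
    exact hwa (hF.right.left_unique hE.left)
  have hcode := h.code_erase hF hwP hiso
  have hlt := Finset.card_erase_lt_of_mem hF.left.2.1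
  have ih := (h.erase hF hwP hiso).ear_of_code
    ⟨hE.left.erase hwa hwv, hE.right.erase hwv hwb, hE.ne⟩
    ((Multiset.mem_cons.1 (hcode ▸ ha)).resolve_left hxa)
    (fun hc => hv (hcode ▸ Multiset.mem_cons_of_mem hc))
  refine ⟨ih.1, fun e he => ?_⟩
  by_cases hes : e = seg x y
  · rcases seg_fst_snd hes with ⟨h1, h2⟩ | ⟨h1, h2⟩ <;> rw [h1, h2]
    · exact ⟨hxv, hyv⟩
    · exact ⟨hyv, hxv⟩
  · exact ih.2 e (Finset.mem_erase.2 ⟨hes, he⟩)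
termination_by V.card

theorem Config.refl (h : 3 ≤ V.card) : Config V ∅ V where
  diag := by simp
  nc := by simp
  sub := subset_rfl
  card := h
  side _ he := Or.inl he
  ndiag := by simp

theorem Tight.eq_empty_iff (h : Tight V D P) : D = ∅ ↔ P = V := by
  have := h.card_eq
  refine ⟨fun hD => ?_, fun hP => ?_⟩
  · exact Finset.eq_of_subset_of_card_le h.sub (by simp [hD] at this; omega)
  · subst hP
    exact Finset.card_eq_zero.1 (by omega)

theorem code_eq_zero : code P D = 0 ↔ D = ∅ := by
  simp [code]

theorem card_code : Multiset.card (code P D) = D.card := by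
  simp [code]

/-! ### Bijectivity of the code and the count. -/

theorem exists_ear_of_multiset {M : Multiset (Fin n)} (h3 : 3 ≤ V.card)
    (hM : ∀ x ∈ M, x ∈ V) (hlt : Multiset.card M < V.card) (h0 : M ≠ 0) :
    ∃ a v b, Ear V a v b ∧ a ∈ M ∧ v ∉ M := by
  obtain ⟨s, hs⟩ := Multiset.exists_mem_of_ne_zero h0
  obtain ⟨z, hz, hzM⟩ : ∃ z ∈ V, z ∉ M := by
    by_contra! hc
    have h1 : V ⊆ M.toFinset := fun x hx => Multiset.mem_toFinset.2 (hc x hx)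
    have := Finset.card_le_card h1
    have := M.toFinset_card_le
    omega
  obtain ⟨a, v, hav, ha, hv⟩ := exists_next_mem_not_mem (p := (· ∈ M)) (hM s hs) hs hz hzM
  obtain ⟨a', b, hE⟩ := (Config.refl h3).exists_ear hav.2.1
  exact ⟨a, v, b, hE.left.left_unique hav ▸ hE, ha, hv⟩

theorem exists_tight_code {V : Finset (Fin n)} {M : Multiset (Fin n)} (hM : ∀ x ∈ M, x ∈ V)
    (hc : Multiset.card M + 3 ≤ V.card) : ∃ D P, Tight V D P ∧ code P D = M := by
  by_cases h0 : M = 0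
  · subst h0
    exact ⟨∅, V, ⟨Config.refl (by simpa using hc), by simp⟩, by simp [code]⟩
  · obtain ⟨a, v, b, hE, ha, hv⟩ := exists_ear_of_multiset (by omega) hM (by omega) h0
    have hlt := Finset.card_erase_add_one hE.left.2.1
    have hltM := Multiset.card_erase_add_one ha
    obtain ⟨D, P, h, hcode⟩ := exists_tight_code (V := V.erase v) (M := M.erase a)
      (fun x hx => by
        have := Multiset.mem_of_mem_erase hx
        exact Finset.mem_erase.2 ⟨fun hxv => hv (hxv ▸ this), hM x this⟩) (by omega)
    exact ⟨_, P, h.insert hE, by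
      rw [hE.code_insert h.toConfig, hcode, Multiset.cons_erase ha]⟩
termination_by V.card

/-- The ear is chosen from `V` and the common code alone, so the same ear comes off both
configurations. -/
theorem tight_code_injective {V P Q : Finset (Fin n)} {D E : Finset (Fin n × Fin n)}
    (hD : Tight V D P) (hE : Tight V E Q) (h : code P D = code Q E) : D = E ∧ P = Q := by
  by_cases h0 : code P D = 0
  · have hD0 := code_eq_zero.1 h0
    have hE0 := code_eq_zero.1 (h ▸ h0)
    exact ⟨hD0.trans hE0.symm, (hD.eq_empty_iff.1 hD0).trans (hE.eq_empty_iff.1 hE0).symm⟩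
  · have hV : 3 ≤ V.card := hD.card.trans (Finset.card_le_card hD.sub)
    obtain ⟨a, v, b, hear, ha, hv⟩ := exists_ear_of_multiset hV (M := code P D) (fun x hx => by
        obtain ⟨e, he, h1⟩ := exists_mem_of_mem_code hx
        have := hD.diag e he
        exact h1.elim (· ▸ this.1) (· ▸ this.2.1))
      (by have := hD.card_eq; have := hD.card; rw [card_code]; omega) h0
    obtain ⟨hvP, hisoD⟩ := hD.ear_of_code hear ha hv
    obtain ⟨hvQ, hisoE⟩ := hE.ear_of_code hear (h ▸ ha) (h ▸ hv)
    have hlt := Finset.card_erase_lt_of_mem hear.left.2.1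
    obtain ⟨h1, h2⟩ := tight_code_injective (hD.erase hear hvP hisoD) (hE.erase hear hvQ hisoE) (by
      rwa [hD.code_erase hear hvP hisoD, hE.code_erase hear hvQ hisoE, Multiset.cons_inj_right]
        at h)
    refine ⟨?_, h2⟩
    rw [← Finset.insert_erase (hD.seg_mem hear hvP hisoD),
      ← Finset.insert_erase (hE.seg_mem hear hvQ hisoE), h1]
termination_by V.card

open Classical in
theorem card_tight (k : ℕ) (hk : 3 ≤ k) (hkn : k ≤ n) :
    (Finset.univ.filter fun p : Finset (Fin n × Fin n) × Finset (Fin n) =>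
      Tight Finset.univ p.1 p.2 ∧ p.2.card = k).card = (2 * n - k - 1).choose (n - 1) := by
  have hsym : Fintype.card (Sym (Fin n) (n - k)) = (2 * n - k - 1).choose (n - 1) := by
    rw [Sym.card_sym_eq_choose, Fintype.card_fin, show n + (n - k) - 1 = 2 * n - k - 1 by omega]
    exact Nat.choose_symm_of_eq_add (by omega)
  rw [← hsym, ← Finset.card_univ]
  have hcard : ∀ p : Finset (Fin n × Fin n) × Finset (Fin n),
      p ∈ (Finset.univ.filter fun p => Tight Finset.univ p.1 p.2 ∧ p.2.card = k) →
      Tight Finset.univ p.1 p.2 ∧ Multiset.card (code p.2 p.1) = n - k := fun p hp => by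
    obtain ⟨h1, h2⟩ := (Finset.mem_filter.1 hp).2
    have := h1.card_eq
    rw [Finset.card_univ, Fintype.card_fin] at this
    exact ⟨h1, by rw [card_code]; omega⟩
  refine Finset.card_bij (fun p hp => ⟨code p.2 p.1, (hcard p hp).2⟩) (fun _ _ => Finset.mem_univ _)
    (fun p hp q hq h => ?_) fun M _ => ?_
  · obtain ⟨h1, h2⟩ := tight_code_injective (hcard p hp).1 (hcard q hq).1 (congrArg Subtype.val h)
    exact Prod.ext h1 h2
  · obtain ⟨M, hM⟩ := M
    obtain ⟨D, P, h, hc⟩ := exists_tight_code (V := Finset.univ) (M := M)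
      (fun x _ => Finset.mem_univ x) (by rw [hM, Finset.card_univ, Fintype.card_fin]; omega)
    refine ⟨(D, P), ?_, Subtype.ext hc⟩
    simp only [Finset.mem_filter, Finset.mem_univ, true_and]
    have := h.card_eq
    rw [Finset.card_univ, Fintype.card_fin, ← card_code (P := P), hc, hM] at this
    exact ⟨h, by omega⟩

/-! ### Part sizes of a tight configuration. -/

theorem Next.mono (h : Next V a v) (hs : P ⊆ V) (ha : a ∈ P) (hv : v ∈ P) : Next P a v := by
  unfold Next at *; grind

theorem Next.ne_of_next (h : 3 ≤ Q.card) (h1 : Next Q x v) (h2 : Next Q v y) : x ≠ y := by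
  obtain ⟨p, hp, hpx, hpv⟩ := exists_mem_ne_ne h x v
  unfold Next at *
  grind

/-- If `Q` skipped the successor of some `a ∈ Q`, the side of `Q` leaving `a` would have to be the
side of `V` entering `a`, making one vertex both neighbours of `a` in `Q`. -/
theorem Config.eq_of_empty (h : Config V ∅ Q) : Q = V := by
  by_contra hne
  obtain ⟨z, hz, hzQ⟩ := Finset.exists_of_ssubset (h.sub.ssubset_of_ne hne)
  obtain ⟨x, hx, -⟩ := exists_mem_ne_ne h.card z z
  obtain ⟨a, v, hav, ha, hv⟩ := exists_next_mem_not_mem (p := (· ∈ Q)) (h.sub hx) hx hz hzQ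
  obtain ⟨w, hw, hwa, -⟩ := exists_mem_ne_ne h.card a a
  obtain ⟨y, hay⟩ := exists_next ha hw hwa
  have hs := (h.side _ hay.isSide).resolve_right (Finset.notMem_empty _)
  rcases hs.next with h1 | h1
  · exact hv (hav.right_unique h1 ▸ hay.2.1)
  · exact Next.ne_of_next h.card hay (h1.mono h.sub hay.2.1 ha) rfl

theorem seg_comm (h : a ≠ b) : seg a b = seg b a := by
  unfold seg; grind

theorem Config.eq_triangle (h : Config V D Q) (hE : Ear V a v b)
    (hiso : ∀ e ∈ D, e.1 ≠ v ∧ e.2 ≠ v) (hab : seg a b ∈ D) (hv : v ∈ Q) : Q = {a, v, b} := by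
  obtain ⟨w, hw, hwv, -⟩ := exists_mem_ne_ne h.card v v
  obtain ⟨y, hy⟩ := exists_next hv hw hwv
  obtain ⟨z, hz⟩ := exists_prev hv hw hwv
  have hzy := Next.ne_of_next h.card hz hy
  have hmem : ∀ x, x ∈ Q → IsSide Q (seg x v) → x = a ∨ x = b := fun x hx hs => by
    rcases h.side _ hs with h1 | h1
    · rcases h1.next with h1 | h1
      · exact Or.inl (h1.left_unique hE.left)
      · exact Or.inr (h1.right_unique hE.right)
    · have := hiso _ h1
      rcases seg_fst_snd (rfl : seg x v = seg x v) with h2 | h2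
      · exact absurd h2.2 this.2
      · exact absurd h2.1 this.1
  have hvy : v ≠ y := by
    rintro rfl
    have := hy.2.2
    simp at this
  have hy' := hmem y hy.2.1 (seg_comm hvy ▸ hy.isSide)
  have hz' := hmem z hz.1 hz.isSide
  have haQ : a ∈ Q := by have := hy.2.1; have := hz.1; grind
  have hbQ : b ∈ Q := by have := hy.2.1; have := hz.1; grind
  have hEQ : Ear Q a v b := ⟨hE.left.mono h.sub haQ hv, hE.right.mono h.sub hv hbQ, hE.ne⟩
  ext x
  simp only [Finset.mem_insert, Finset.mem_singleton]
  refine ⟨fun hx => ?_, ?_⟩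
  · by_contra! hc
    exact h.ndiag _ (hEQ.isDiagonal_seg hx hc.1 hc.2.2 hc.2.1) hab
  · rintro (rfl | rfl | rfl) <;> assumption

theorem Ear.distinct (hE : Ear V a v b) : a ≠ v ∧ v ≠ b ∧ a ≠ b := by
  obtain ⟨h1, h2, h3⟩ := hE
  unfold Next at *
  grind

theorem eq_seg_of_mem_triple (h1 : e.1 ∈ ({a, v, b} : Finset (Fin n)))
    (h2 : e.2 ∈ ({a, v, b} : Finset (Fin n))) (hlt : e.1 < e.2) :
    e = seg a v ∨ e = seg v b ∨ e = seg a b := by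
  obtain ⟨i, j⟩ := e
  unfold seg
  simp only [Finset.mem_insert, Finset.mem_singleton] at *
  grind

theorem isSide_triple (h1 : e.1 ∈ ({a, v, b} : Finset (Fin n)))
    (h2 : e.2 ∈ ({a, v, b} : Finset (Fin n))) (hlt : e.1 < e.2) :
    IsSide ({a, v, b} : Finset (Fin n)) e := by
  refine ⟨h1, h2, hlt, ?_⟩
  simp only [Finset.mem_insert, Finset.mem_singleton, forall_eq_or_imp, forall_eq] at *
  grind

theorem Ear.card_triple (hE : Ear V a v b) : ({a, v, b} : Finset (Fin n)).card = 3 := by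
  obtain ⟨h1, h2, h3⟩ := hE.distinct
  exact Finset.card_eq_three.2 ⟨a, v, b, h1, h3, h2, rfl⟩

theorem Config.triangle (h : Config V D Q) (hE : Ear V a v b) (hab : seg a b ∈ D) :
    Config V D {a, v, b} where
  diag := h.diag
  nc := h.nc
  sub x hx := by
    simp only [Finset.mem_insert, Finset.mem_singleton] at hx
    rcases hx with rfl | rfl | rfl
    exacts [hE.left.1, hE.left.2.1, hE.right.2.1]
  card := hE.card_triple.ge
  side e he := by
    rcases eq_seg_of_mem_triple he.1 he.2.1 he.2.2.1 with rfl | rfl | rfl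
    · exact Or.inl hE.left.isSide
    · exact Or.inl hE.right.isSide
    · exact Or.inr hab
  ndiag e he := absurd (isSide_triple he.1 he.2.1 he.2.2.1) he.2.2.2

open Classical in
-- Attaching an ear adds exactly one part, its triangle: by `Config.eq_triangle` no other part
-- contains the tip.
theorem Tight.map_card_parts {V P : Finset (Fin n)} {D : Finset (Fin n × Fin n)}
    (h : Tight V D P) :
    (Finset.univ.filter (Config V D)).val.map Finset.card =
      P.card ::ₘ Multiset.replicate (V.card - P.card) 3 := by
  by_cases hP : P = V
  · have hD := h.eq_empty_iff.2 hP
    subst hP hD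
    have : Finset.univ.filter (Config P ∅) = {P} := by
      ext Q
      simp only [Finset.mem_filter, Finset.mem_univ, true_and, Finset.mem_singleton]
      exact ⟨Config.eq_of_empty, fun hQ => hQ ▸ h.toConfig⟩
    simp [this]
  · obtain ⟨a, v, b, hE, hvP, hiso, hab⟩ := h.exists_ear hP
    have herase := h.erase hE hvP hiso
    have hlt := Finset.card_erase_add_one hE.left.2.1
    have hle := Finset.card_le_card herase.sub
    have hnot : ({a, v, b} : Finset (Fin n)) ∉
        Finset.univ.filter (Config (V.erase v) (D.erase (seg a b))) := fun hc => by
      have := (Finset.mem_filter.1 hc).2.sub (show v ∈ ({a, v, b} : Finset (Fin n)) by simp)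
      simp at this
    have hset : Finset.univ.filter (Config V D) = Insert.insert {a, v, b}
        (Finset.univ.filter (Config (V.erase v) (D.erase (seg a b)))) := by
      ext Q
      simp only [Finset.mem_filter, Finset.mem_univ, true_and, Finset.mem_insert]
      constructor
      · intro hQ
        by_cases hv : v ∈ Q
        · exact Or.inl (hQ.eq_triangle hE hiso hab hv)
        · exact Or.inr (hQ.erase hE hv hiso)
      · rintro (rfl | hQ)
        · exact h.toConfig.triangle hE hab
        · exact Finset.insert_erase hab ▸ hQ.insert hE
    rw [hset, Finset.insert_val_of_notMem hnot, Multiset.map_cons, herase.map_card_parts,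
      hE.card_triple, Multiset.cons_swap, ← Multiset.replicate_succ]
    congr 2
    omega
termination_by V.card

/-! ### Back to dissections of the `n`-gon. -/

theorem isPart_iff_config {m : ℕ} (hD : IsDissection m D) :
    IsPart D P ↔ Config Finset.univ D P :=
  ⟨fun h => ⟨hD.2.1, hD.2.2, Finset.subset_univ P, h.1, h.2.1, h.2.2⟩,
    fun h => ⟨h.card, h.side, h.ndiag⟩⟩

theorem tight_iff {k : ℕ} (hkn : k ≤ n) :
    Tight Finset.univ D P ∧ P.card = k ↔ IsDissection (n - k) D ∧ P ∈ parts D ∧ P.card = k := by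
  have hn : (Finset.univ : Finset (Fin n)).card = n := by simp
  constructor
  · rintro ⟨h, hk⟩
    have hd : IsDissection (n - k) D := ⟨by have := h.card_eq; omega, h.diag, h.nc⟩
    exact ⟨hd, Finset.mem_filter.2 ⟨Finset.mem_univ _, (isPart_iff_config hd).2 h.toConfig⟩, hk⟩
  · rintro ⟨hd, hP, hk⟩
    refine ⟨⟨(isPart_iff_config hd).1 (Finset.mem_filter.1 hP).2, ?_⟩, hk⟩
    rw [hd.1, hn]
    omega

theorem Tight.map_card_parts_univ {k : ℕ} (hkn : k ≤ n) (h : Tight Finset.univ D P)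
    (hk : P.card = k) : (parts D).val.map Finset.card = k ::ₘ Multiset.replicate (n - k) 3 := by
  classical
  have hd := ((tight_iff hkn).1 ⟨h, hk⟩).1
  have : parts D = Finset.univ.filter (Config Finset.univ D) := by
    ext Q
    simp [parts, isPart_iff_config hd]
  rw [this, h.map_card_parts, hk, Finset.card_univ, Fintype.card_fin]

theorem eq_of_map_card_eq {s : Finset (Finset (Fin n))} {k m : ℕ} (hk : k ≠ 3)
    (h : s.val.map Finset.card = k ::ₘ Multiset.replicate m 3) (hP : P ∈ s) (hQ : Q ∈ s)
    (hPk : P.card = k) (hQk : Q.card = k) : P = Q := by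
  have hcount := congrArg (Multiset.count k) h
  rw [Multiset.count_map, Multiset.count_cons_self, Multiset.count_replicate,
    if_neg (Ne.symm hk)] at hcount
  have : (s.filter fun R => k = R.card).card = 1 := hcount
  exact Finset.card_le_one.1 this.le P (by simp [hP, hPk]) Q (by simp [hQ, hQk])

end PolygonDissection

theorem mainTheorem2 (k n : ℕ) (hk : 3 ≤ k) (hkn : k ≤ n) :
    PolygonDissection.f k n = Nat.choose (2 * n - k - 1) (n - 1) := by
  classical
  rw [← PolygonDissection.card_tight k hk hkn, PolygonDissection.f]
  split_ifs with h3
  · subst h3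
    congr 1
    ext p
    simp only [Finset.mem_filter, Finset.mem_univ, true_and]
    exact (PolygonDissection.tight_iff hkn).symm
  -- For `k ≠ 3` the part `P` is the only `k`-gon among the parts, so forgetting it loses nothing.
  · refine (Finset.card_bij (fun p _ => p.1) (fun p hp => ?_) (fun p hp q hq h => ?_)
      fun D hD => ?_).symm
    · obtain ⟨h1, h2⟩ := (Finset.mem_filter.1 hp).2
      exact Finset.mem_filter.2 ⟨Finset.mem_univ _,
        ((PolygonDissection.tight_iff hkn).1 ⟨h1, h2⟩).1, h1.map_card_parts_univ hkn h2⟩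
    · obtain ⟨hp1, hp2⟩ := (Finset.mem_filter.1 hp).2
      obtain ⟨D, P⟩ := p
      obtain ⟨E, Q⟩ := q
      obtain rfl : D = E := h
      have hq' := (PolygonDissection.tight_iff hkn).1 (Finset.mem_filter.1 hq).2
      have hp' := (PolygonDissection.tight_iff hkn).1 ⟨hp1, hp2⟩
      exact Prod.ext rfl (PolygonDissection.eq_of_map_card_eq h3
        (hp1.map_card_parts_univ hkn hp2) hp'.2.1 hq'.2.1 hp2 hq'.2.2)
    · obtain ⟨h1, h2⟩ := (Finset.mem_filter.1 hD).2
      obtain ⟨P, hP, hPk⟩ := Multiset.mem_map.1 (h2 ▸ Multiset.mem_cons_self k _)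
      exact ⟨(D, P), Finset.mem_filter.2 ⟨Finset.mem_univ _,
        (PolygonDissection.tight_iff hkn).2 ⟨h1, hP, hPk⟩⟩, rfl⟩
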